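/- Let $\Omega$ be a nonempty compact Hausdorff space and let $X\neq\{0\}$ be a real or complex Banach space. Let $\mathrm{WC}(\Omega,X)$ be the space of functions $f:\Omega\to X$ that are continuous for the weak topology of $X$, with the norm $\|f\|=\sup_{\omega\in\Omega}\|f(\omega)\|$. For a normed space $E$, let $E_1^*$ be the closed unit ball of $E^*$, and call $\varphi\in E_1^*$ a w$^*$-w PC if the identity map $(E_1^*,w^*)\to(E_1^*,w)$ is continuous at $\varphi$, where $w^*=\sigma(E^*,E)$ and $w=\sigma(E^*,E^{**})$. For $\omega\in\Omega$ and $x^*\in X^*$, let $\delta_\omega\otimes x^*$ be the functional $f\mapsto x^*(f(\omega))$ on $\mathrm{WC}(\Omega,X)$. If $\Lambda\in \mathrm{WC}(\Omega,X)_1^*$ is a w$^*$-w PC, then there are a finite or countably infinite index set $J\subseteq\mathbb N$, distinct isolated points $\omega_i$ of $\Omega$, numbers $\alpha_i\in(0,1]$ and functionals $x_i^*\in X_1^*$ $(i\in J)$ such that $\sum_{i\in J}\alpha_i=1$, each $x_i^*$ is a w$^*$-w PC of $X_1^*$, and $$\Lambda=\sum_{i\in J}\alpha_i\,\delta_{\omega_i}\otimes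 x_i^*,$$ the series converging in the norm of $\mathrm{WC}(\Omega,X)^*$. -/

import Mathlib

open scoped ENNReal Topology

noncomputable section

/-- `WC 𝕜 Ω X` is the space of functions `Ω → X` that are continuous when `X` carries its weak
topology, with the supremum norm (the norm of `ℓ^∞(Ω, X)`). For compact `Ω` boundedness is
automatic, see `WC.exists_coe_eq`. -/
def WC (𝕜 : Type*) [RCLike 𝕜] (Ω : Type*) [TopologicalSpace Ω]
    (X : Type*) [NormedAddCommGroup X] [NormedSpace 𝕜 X] :
    Submodule 𝕜 (lp (fun _ : Ω => X) ∞) where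
  carrier := {f | Continuous fun t : Ω => toWeakSpace 𝕜 X (f t)}
  zero_mem' := by
    simpa using (continuous_const : Continuous fun _ : Ω => toWeakSpace 𝕜 X 0)
  add_mem' := by
    intro f g hf hg
    exact (Continuous.add (Set.mem_ofPred_eq ▸ hf) (Set.mem_ofPred_eq ▸ hg) :)
  smul_mem' := by
    intro c f hf
    exact (Continuous.const_smul (Set.mem_ofPred_eq ▸ hf) c :)

/-- Every weakly continuous function on a compact space is the underlying function of an element
of `WC 𝕜 Ω X`. -/
theorem WC.exists_coe_eq {𝕜 : Type*} [RCLike 𝕜] {Ω : Type*} [TopologicalSpace Ω] [CompactSpace Ω]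
    {X : Type*} [NormedAddCommGroup X] [NormedSpace 𝕜 X]
    (f : Ω → X) (hf : Continuous fun t : Ω => toWeakSpace 𝕜 X (f t)) :
    ∃ g : WC 𝕜 Ω X, ∀ t, g.1 t = f t := by
  have hb : ∃ C, ∀ t, ‖NormedSpace.inclusionInDoubleDual 𝕜 X (f t)‖ ≤ C := by
    refine banach_steinhaus fun φ => ?_
    have hc : Continuous fun t => φ (f t) :=
      (WeakBilin.eval_continuous (topDualPairing 𝕜 X).flip φ).comp hf
    obtain ⟨C, hC⟩ := isCompact_univ.exists_bound_of_continuousOn hc.continuousOn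
    exact ⟨C, fun t => by simpa using hC t (Set.mem_univ t)⟩
  obtain ⟨C, hC⟩ := hb
  have hm : Memℓp (E := fun _ : Ω => X) f ∞ := by
    refine memℓp_infty ⟨C, ?_⟩
    rintro _ ⟨t, rfl⟩
    have h := hC t
    rwa [show ‖NormedSpace.inclusionInDoubleDual 𝕜 X (f t)‖ = ‖f t‖ from
      (NormedSpace.inclusionInDoubleDualLi 𝕜 (E := X)).norm_map (f t)] at h
  exact ⟨⟨⟨f, hm⟩, hf⟩, fun _ => rfl⟩

/-- The functional `δ_t ⊗ φ` on `WC 𝕜 Ω X`, that is `f ↦ φ (f t)`. -/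
def WC.diracTensor {𝕜 : Type*} [RCLike 𝕜] {Ω : Type*} [TopologicalSpace Ω]
    {X : Type*} [NormedAddCommGroup X] [NormedSpace 𝕜 X] (t : Ω) (φ : StrongDual 𝕜 X) :
    StrongDual 𝕜 (WC 𝕜 Ω X) :=
  LinearMap.mkContinuous
    { toFun := fun f => φ (f.1 t)
      map_add' := fun f g => by simp
      map_smul' := fun c f => by simp }
    ‖φ‖
    (fun f => (φ.le_opNorm (f.1 t)).trans
      (mul_le_mul_of_nonneg_left (lp.norm_apply_le_norm ENNReal.top_ne_zero f.1 t)
        (norm_nonneg φ)))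

/-- `φ` lies in the closed unit ball of the dual of `E`, and the identity map of that ball, from
the weak* topology to the weak topology of the Banach space `E*`, is continuous at `φ`. -/
def IsWeakStarWeakPC (𝕜 : Type*) [RCLike 𝕜] {E : Type*} [NormedAddCommGroup E] [NormedSpace 𝕜 E]
    (φ : StrongDual 𝕜 E) : Prop :=
  ‖φ‖ ≤ 1 ∧
    ContinuousWithinAt
      (fun ψ : WeakDual 𝕜 E => toWeakSpace 𝕜 (StrongDual 𝕜 E) (WeakDual.toStrongDual ψ))
      {ψ : WeakDual 𝕜 E | ‖WeakDual.toStrongDual ψ‖ ≤ 1}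
      (StrongDual.toWeakDual φ)

end

/-! The functionals `∑ t, δ_t ⊗ y t` form an isometric copy of `ℓ¹(Ω, X*)` in the dual. The image of
its unit ball is convex, norm-closed and norming, hence weak*-dense in the dual ball. At a point of
continuity, weak* approximation is weak approximation, so Mazur's theorem puts `Λ` in that image
(`IsWeakStarWeakPC.mem_of_norming`).

Each coordinate is then perturbed inside the ball: sliding mass from `t` to nearby points forces `t`
to be isolated, and varying the functional at `t` shows that it is itself a point of continuity.
Both use elements of the bidual that read a single coordinate (`exists_bidual_extension`). -/

/-! ### Points of continuity and norming sets -/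

/-- Hahn–Banach separation, since every continuous functional for the topology of `B` is an
evaluation. -/
theorem WeakBilin.mem_closure_of_forall_re_le {𝕜 V F : Type*} [RCLike 𝕜] [AddCommGroup V]
    [Module 𝕜 V] [Module ℝ V] [IsScalarTower ℝ 𝕜 V] [AddCommGroup F] [Module 𝕜 F]
    {B : V →ₗ[𝕜] F →ₗ[𝕜] 𝕜} {D : Set (WeakBilin B)} (hD : Convex ℝ D) {φ : WeakBilin B}
    (h : ∀ (e : F) (c : ℝ), (∀ ψ ∈ D, RCLike.re (WeakBilin.eval B e ψ) ≤ c) →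
      RCLike.re (WeakBilin.eval B e φ) ≤ c) : φ ∈ closure D := by
  by_contra hnot
  have : ContinuousSMul ℝ (WeakBilin B) := IsScalarTower.continuousSMul 𝕜
  obtain ⟨g, u, hlt, hgt⟩ := RCLike.geometric_hahn_banach_closed_point (𝕜 := 𝕜)
    hD.closure isClosed_closure hnot
  obtain ⟨e, rfl⟩ := LinearMap.dualEmbedding_surjective B g
  exact absurd hgt (not_lt.2 (h e u fun ψ hψ => (hlt ψ (subset_closure hψ)).le))

/-- A norm-closed convex subset of the dual ball that is norming for `E` contains every
w*-w point of continuity of the dual ball. -/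
theorem IsWeakStarWeakPC.mem_of_norming {𝕜 : Type*} [RCLike 𝕜] {E : Type*}
    [NormedAddCommGroup E] [NormedSpace 𝕜 E] {φ : StrongDual 𝕜 E} (hφ : IsWeakStarWeakPC 𝕜 φ)
    {D : Set (StrongDual 𝕜 E)} (hconv : Convex ℝ D) (hclosed : IsClosed D)
    (hball : ∀ ψ ∈ D, ‖ψ‖ ≤ 1)
    (hnorming : ∀ (e : E) (c : ℝ), (∀ ψ ∈ D, RCLike.re (ψ e) ≤ c) → ‖e‖ ≤ c) : φ ∈ D := by
  obtain ⟨hφ1, hφc⟩ := hφ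
  have hdense : StrongDual.toWeakDual φ ∈ closure (WeakDual.toStrongDual ⁻¹' D) :=
    WeakBilin.mem_closure_of_forall_re_le (B := topDualPairing 𝕜 E) (D := D) (φ := φ) hconv
      fun e c hc => ((RCLike.re_le_norm (φ e)).trans ((φ.le_opNorm e).trans
        (mul_le_of_le_one_left (norm_nonneg e) hφ1))).trans (hnorming e c hc)
  have hmem := ContinuousWithinAt.mem_closure_image
    (hφc.mono (s := WeakDual.toStrongDual ⁻¹' D) fun ψ hψ => hball _ hψ) hdense
  have hsub : (fun ψ : WeakDual 𝕜 E =>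
      toWeakSpace 𝕜 (StrongDual 𝕜 E) (WeakDual.toStrongDual ψ)) ''
        (WeakDual.toStrongDual ⁻¹' D) ⊆ toWeakSpace 𝕜 (StrongDual 𝕜 E) '' D := by
    rintro _ ⟨ψ, hψ, rfl⟩
    exact ⟨_, hψ, rfl⟩
  have hmem := closure_mono hsub hmem
  -- Mazur: weak and norm closures of a convex set agree.
  rw [← hconv.toWeakSpace_closure (𝕜 := 𝕜), hclosed.closure_eq] at hmem
  obtain ⟨ψ, hψ, h⟩ := hmem
  obtain rfl : ψ = φ := (toWeakSpace 𝕜 (StrongDual 𝕜 E)).injective h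
  exact hψ

theorem isWeakStarWeakPC_iff {𝕜 : Type*} [RCLike 𝕜] {E : Type*} [NormedAddCommGroup E]
    [NormedSpace 𝕜 E] {φ : StrongDual 𝕜 E} :
    IsWeakStarWeakPC 𝕜 φ ↔ ‖φ‖ ≤ 1 ∧ ∀ Φ : StrongDual 𝕜 (StrongDual 𝕜 E),
      ContinuousWithinAt (fun ψ : WeakDual 𝕜 E => Φ (WeakDual.toStrongDual ψ))
        {ψ : WeakDual 𝕜 E | ‖WeakDual.toStrongDual ψ‖ ≤ 1} (StrongDual.toWeakDual φ) := by
  refine and_congr_right fun _ => ?_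
  exact WeakBilin.tendsto_iff_forall_eval_tendsto (B := (topDualPairing 𝕜 (StrongDual 𝕜 E)).flip)
    (fun a b h => by
      exact (SeparatingDual.eq_iff_forall_dual_eq (R := 𝕜) (V := StrongDual 𝕜 E)).2
        fun Φ => LinearMap.congr_fun h Φ)

theorem StrongDual.exists_norm_le_one_lt_re {𝕜 : Type*} [RCLike 𝕜] {E : Type*}
    [NormedAddCommGroup E] [NormedSpace 𝕜 E] (φ : StrongDual 𝕜 E) {r : ℝ} (hr : r < ‖φ‖) :
    ∃ x : E, ‖x‖ ≤ 1 ∧ ∃ s : ℝ, r < s ∧ φ x = (s : 𝕜) := by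
  obtain hr0 | hr0 := lt_or_ge r 0
  · exact ⟨0, by simp, 0, hr0, by simp⟩
  obtain ⟨x, hx, hlt⟩ := φ.exists_lt_apply_of_lt_opNorm hr
  have hne : (‖φ x‖ : 𝕜) ≠ 0 := by
    simpa using fun h : φ x = 0 => absurd hlt (by simpa [h] using hr0)
  obtain ⟨c, hc, hcx⟩ := RCLike.exists_norm_eq_mul_self (φ x)
  refine ⟨c • x, ?_, ‖φ x‖, hlt, ?_⟩
  · rw [norm_smul, hc, one_mul]; exact hx.le
  · rw [map_smul, smul_eq_mul, hcx]

theorem exists_linearIsometry_lp_one_hasSum {𝕜 ι Y V : Type*} [RCLike 𝕜]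
    [NormedAddCommGroup Y] [NormedSpace 𝕜 Y] [NormedAddCommGroup V] [NormedSpace 𝕜 V]
    [CompleteSpace V] (d : ι → Y →ₗ[𝕜] V)
    (hd : ∀ (F : Finset ι) (y : ι → Y), ‖∑ i ∈ F, d i (y i)‖ = ∑ i ∈ F, ‖y i‖) :
    ∃ T : lp (fun _ : ι => Y) 1 →ₗᵢ[𝕜] V, ∀ y, HasSum (fun i => d i (y i)) (T y) := by
  have hn (y : lp (fun _ : ι => Y) 1) : HasSum (fun i => ‖y i‖) ‖y‖ := by
    simpa using lp.hasSum_norm (by simp) y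
  have hs (y : lp (fun _ : ι => Y) 1) : Summable fun i => d i (y i) :=
    Summable.of_norm_bounded (hn y).summable fun i => by simpa using (hd {i} y).le
  let T : lp (fun _ : ι => Y) 1 →ₗ[𝕜] V :=
    { toFun := fun y => ∑' i, d i (y i)
      map_add' := fun y z => by
        rw [← (hs y).tsum_add (hs z)]
        exact tsum_congr fun i => by simp
      map_smul' := fun c y => by
        rw [RingHom.id_apply, ← (hs y).tsum_const_smul c]
        exact tsum_congr fun i => by simp }
  have hT (y : lp (fun _ : ι => Y) 1) : HasSum (fun i => d i (y i)) (T y) := (hs y).hasSum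
  refine ⟨⟨T, fun y => tendsto_nhds_unique (Filter.Tendsto.norm (hT y)) ?_⟩, hT⟩
  simpa only [hd] using! hn y

/-! ### Abstract sup-norm function spaces -/

/-- A family of evaluations `ev t : E → X`, `t ∈ Ω`, that exhibits `E` as a space of weakly
continuous functions with the supremum norm, in which values at finitely many points can be
prescribed without increasing the norm. -/
structure IsSupNormEvaluation (𝕜 : Type*) [RCLike 𝕜] {Ω E X : Type*} [TopologicalSpace Ω]
    [NormedAddCommGroup E] [NormedSpace 𝕜 E] [NormedAddCommGroup X] [NormedSpace 𝕜 X]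
    (ev : Ω → E →L[𝕜] X) : Prop where
  norm_apply_le : ∀ t f, ‖ev t f‖ ≤ ‖f‖
  norm_le_of_forall_le : ∀ (f : E) (C : ℝ), 0 ≤ C → (∀ t, ‖ev t f‖ ≤ C) → ‖f‖ ≤ C
  continuous_apply : ∀ (f : E) (φ : StrongDual 𝕜 X), Continuous fun t => φ (ev t f)
  exists_norm_le_one : ∀ (F : Finset Ω) (x : Ω → X), (∀ t ∈ F, ‖x t‖ ≤ 1) →
    ∃ f : E, ‖f‖ ≤ 1 ∧ ∀ t ∈ F, ev t f = x t

namespace IsSupNormEvaluation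

variable {𝕜 : Type*} [RCLike 𝕜] {Ω E X : Type*} [TopologicalSpace Ω]
  [NormedAddCommGroup E] [NormedSpace 𝕜 E] [NormedAddCommGroup X] [NormedSpace 𝕜 X]
  {ev : Ω → E →L[𝕜] X}

theorem norm_comp_le (h : IsSupNormEvaluation 𝕜 ev) (t : Ω) (φ : StrongDual 𝕜 X) :
    ‖φ.comp (ev t)‖ ≤ ‖φ‖ :=
  ContinuousLinearMap.opNorm_le_bound _ (norm_nonneg φ) fun f => (φ.le_opNorm _).trans
    (mul_le_mul_of_nonneg_left (h.norm_apply_le t f) (norm_nonneg φ))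

/-- One function in the unit ball interpolates almost norming vectors for all `y t`, rotated so that
the values are real and add up. -/
theorem norm_sum_comp (h : IsSupNormEvaluation 𝕜 ev) (F : Finset Ω)
    (y : Ω → StrongDual 𝕜 X) : ‖∑ t ∈ F, (y t).comp (ev t)‖ = ∑ t ∈ F, ‖y t‖ := by
  refine le_antisymm (norm_sum_le_of_le F fun t _ => h.norm_comp_le t (y t)) ?_
  refine le_of_forall_pos_le_add fun ε hε => ?_
  set δ := ε / (F.card + 1) with hδ
  have hδ0 : 0 < δ := by positivity
  choose x hx s hs hys using fun t => StrongDual.exists_norm_le_one_lt_re (y t)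
    (sub_lt_self ‖y t‖ hδ0)
  obtain ⟨f, hf, hfx⟩ := h.exists_norm_le_one F x fun t _ => hx t
  have hval : (∑ t ∈ F, (y t).comp (ev t)) f = ((∑ t ∈ F, s t : ℝ) : 𝕜) := by
    rw [sum_apply, RCLike.ofReal_sum]
    exact Finset.sum_congr rfl fun t ht => by
      rw [ContinuousLinearMap.comp_apply, hfx t ht, hys]
  have hle : ∑ t ∈ F, s t ≤ ‖∑ t ∈ F, (y t).comp (ev t)‖ := by
    have h := ContinuousLinearMap.unit_le_opNorm (∑ t ∈ F, (y t).comp (ev t)) f hf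
    rw [hval, RCLike.norm_ofReal] at h
    exact (le_abs_self _).trans h
  have hsum : ∑ t ∈ F, ‖y t‖ ≤ ∑ t ∈ F, (s t + δ) :=
    Finset.sum_le_sum fun t _ => by linarith [hs t]
  rw [Finset.sum_add_distrib, Finset.sum_const, nsmul_eq_mul] at hsum
  have hcard : F.card * δ ≤ ε := by
    rw [hδ, mul_div_assoc', div_le_iff₀ (by positivity)]
    nlinarith
  linarith

/-- `y ↦ ∑ t, δ_t ⊗ y t` is an isometric embedding of `ℓ¹(Ω, X*)` into `E*`. -/
theorem exists_linearIsometry (h : IsSupNormEvaluation 𝕜 ev) :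
    ∃ T : lp (fun _ : Ω => StrongDual 𝕜 X) 1 →ₗᵢ[𝕜] StrongDual 𝕜 E,
      ∀ y, HasSum (fun t => (y t).comp (ev t)) (T y) :=
  exists_linearIsometry_lp_one_hasSum
    (fun t => ((ContinuousLinearMap.compL 𝕜 E X 𝕜).flip (ev t)).toLinearMap) h.norm_sum_comp

omit [TopologicalSpace Ω] in
theorem apply_single_of_hasSum [DecidableEq Ω]
    {T : lp (fun _ : Ω => StrongDual 𝕜 X) 1 →ₗᵢ[𝕜] StrongDual 𝕜 E}
    (hT : ∀ y, HasSum (fun t => (y t).comp (ev t)) (T y)) (t : Ω) (z : StrongDual 𝕜 X) :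
    T (lp.single 1 t z) = z.comp (ev t) := by
  refine (hT _).unique ?_
  convert hasSum_single t fun s hs => ?_
  · simp
  · rw [lp.single_apply_ne _ _ _ hs, ContinuousLinearMap.zero_comp]

/-- An element of `X**`, read off at the coordinate `t`, extends to an element of `E**`. -/
theorem exists_bidual_extension [DecidableEq Ω] (h : IsSupNormEvaluation 𝕜 ev) (t : Ω)
    (Φ : StrongDual 𝕜 (StrongDual 𝕜 X)) :
    ∃ Ψ : StrongDual 𝕜 (StrongDual 𝕜 E), ∀ s (z : StrongDual 𝕜 X),
      Ψ (z.comp (ev s)) = if s = t then Φ z else 0 := by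
  obtain ⟨T, hT⟩ := h.exists_linearIsometry
  -- Hahn–Banach extension of `Φ` applied to the `t`-th coordinate, defined on the copy of `ℓ¹(Ω,
  -- X*)`.
  obtain ⟨Ψ, hΨ, -⟩ := exists_extension_norm_eq (LinearMap.range T.toLinearMap)
    ((Φ.comp (lp.evalCLM 𝕜 (fun _ : Ω => StrongDual 𝕜 X) 1 t)).comp
      T.equivRange.symm.toContinuousLinearEquiv.toContinuousLinearMap)
  refine ⟨Ψ, fun s z => ?_⟩
  rw [← apply_single_of_hasSum hT]
  refine (hΨ (T.equivRange (lp.single 1 s z))).trans ?_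
  have : T.equivRange.symm (T.equivRange (lp.single 1 s z)) = lp.single 1 s z :=
    T.equivRange.symm_apply_apply _
  change Φ ((T.equivRange.symm (T.equivRange (lp.single 1 s z))) t) = _
  rw [this]
  split_ifs with hst
  · subst hst; rw [lp.single_apply_self]
  · rw [lp.single_apply_ne _ _ _ (Ne.symm hst), map_zero]

/-- A w*-w point of continuity of the dual ball is a series `∑ t, δ_t ⊗ y t`. -/
theorem exists_hasSum_of_isWeakStarWeakPC (h : IsSupNormEvaluation 𝕜 ev)
    {Λ : StrongDual 𝕜 E} (hΛ : IsWeakStarWeakPC 𝕜 Λ)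
    {T : lp (fun _ : Ω => StrongDual 𝕜 X) 1 →ₗᵢ[𝕜] StrongDual 𝕜 E}
    (hT : ∀ y, HasSum (fun t => (y t).comp (ev t)) (T y)) :
    ∃ y : lp (fun _ : Ω => StrongDual 𝕜 X) 1, ‖y‖ ≤ 1 ∧ T y = Λ := by
  classical
  suffices hmem : Λ ∈ T '' Metric.closedBall 0 1 by
    obtain ⟨y, hy, hyΛ⟩ := hmem
    exact ⟨y, by simpa using hy, hyΛ⟩
  refine hΛ.mem_of_norming ?_ ?_ ?_ ?_
  · rintro _ ⟨y, hy, rfl⟩ _ ⟨z, hz, rfl⟩ a b ha hb hab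
    refine ⟨(a : 𝕜) • y + (b : 𝕜) • z, ?_, ?_⟩
    · rw [mem_closedBall_zero_iff] at hy hz ⊢
      refine (norm_add_le _ _).trans ?_
      rw [norm_smul, norm_smul, RCLike.norm_of_nonneg ha, RCLike.norm_of_nonneg hb]
      nlinarith
    · rw [map_add, map_smul, map_smul]
      ext f
      simp [RCLike.real_smul_eq_coe_mul]
  · exact T.isometry.isClosedEmbedding.isClosedMap _ Metric.isClosed_closedBall
  · rintro _ ⟨y, hy, rfl⟩
    simpa using hy
  · intro f c hc
    have hc0 : 0 ≤ c := by simpa using hc 0 ⟨0, by simp, by simp⟩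
    refine h.norm_le_of_forall_le f c hc0 fun t => ?_
    obtain ⟨g, hg, hgt⟩ := exists_dual_vector'' 𝕜 (ev t f)
    have := hc (g.comp (ev t)) ⟨lp.single 1 t g, by
      rw [mem_closedBall_zero_iff, lp.norm_single (by simp)]; exact hg,
      apply_single_of_hasSum hT t g⟩
    rwa [ContinuousLinearMap.comp_apply, hgt, RCLike.ofReal_re] at this

/-- If mass `a` of the unit ball may be placed at `t` freely, `t` is isolated. -/
theorem isOpen_singleton_of_isWeakStarWeakPC [Nontrivial X] (h : IsSupNormEvaluation 𝕜 ev)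
    {Λ : StrongDual 𝕜 E} (hΛ : IsWeakStarWeakPC 𝕜 Λ) {t : Ω} {y : StrongDual 𝕜 X} {a : ℝ}
    (ha : 0 < a) (hya : ‖y‖ ≤ a) (hrest : ‖Λ - y.comp (ev t)‖ ≤ 1 - a) :
    IsOpen ({t} : Set Ω) := by
  classical
  -- The movable mass `z` must be nonzero even if `y = 0`; then `z` and `-z`, of norm `a / 2` each,
  -- share the budget `a`.
  obtain ⟨z, hz0, hz⟩ : ∃ z : StrongDual 𝕜 X, z ≠ 0 ∧ ‖y - z‖ + ‖z‖ ≤ a := by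
    by_cases hy : y = 0
    · obtain ⟨v, hv⟩ := exists_ne (0 : X)
      obtain ⟨g, hg, -⟩ := exists_dual_vector 𝕜 v (norm_ne_zero_iff.2 hv)
      have hn : ‖((a / 2 : ℝ) : 𝕜) • g‖ = a / 2 := by
        rw [norm_smul, hg, RCLike.norm_of_nonneg (by positivity), mul_one]
      refine ⟨((a / 2 : ℝ) : 𝕜) • g, ?_, ?_⟩
      · rw [← norm_pos_iff, hn]; positivity
      · rw [hy, zero_sub, norm_neg, hn]; linarith
    · exact ⟨y, hy, by simpa using hya⟩
  obtain ⟨v, hv⟩ : ∃ v, z v ≠ 0 := by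
    by_contra! hall
    exact hz0 (ContinuousLinearMap.ext hall)
  obtain ⟨Ψ, hΨ⟩ := h.exists_bidual_extension t (NormedSpace.inclusionInDoubleDual 𝕜 X v)
  by_contra hopen
  rw [isOpen_singleton_iff_punctured_nhds] at hopen
  have : (𝓝[≠] t).NeBot := ⟨hopen⟩
  let G : Ω → WeakDual 𝕜 E := fun s =>
    StrongDual.toWeakDual (Λ - z.comp (ev t) + z.comp (ev s))
  have hGt : G t = StrongDual.toWeakDual Λ := by simp [G]
  have hGc : Continuous G := WeakDual.continuous_of_continuous_eval fun f =>
    continuous_const.add (h.continuous_apply f z)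
  have hGball (s : Ω) : ‖WeakDual.toStrongDual (G s)‖ ≤ 1 := by
    have heq : WeakDual.toStrongDual (G s) =
        (Λ - y.comp (ev t)) + ((y - z).comp (ev t) + z.comp (ev s)) := by
      ext f; simp [G]; ring
    rw [heq]
    refine (norm_add_le _ _).trans ?_
    have := norm_add_le ((y - z).comp (ev t)) (z.comp (ev s))
    linarith [h.norm_comp_le t (y - z), h.norm_comp_le s z]
  have hlim := (((isWeakStarWeakPC_iff.1 hΛ).2 Ψ).tendsto.comp
    (tendsto_nhdsWithin_iff.2 ⟨hGt ▸ hGc.tendsto t, Filter.Eventually.of_forall hGball⟩)).mono_left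
      (nhdsWithin_le_nhds (s := {t}ᶜ))
  -- `Ψ` sees only the coordinate `t`, so it registers the loss of `z` for every `s ≠ t`, although
  -- `G s` tends weak* to `Λ`.
  have hconst : Filter.Tendsto (fun _ : Ω => Ψ Λ - z v) (𝓝[≠] t) (𝓝 (Ψ Λ)) := by
    refine hlim.congr' ?_
    filter_upwards [self_mem_nhdsWithin] with s hs
    change Ψ (Λ - z.comp (ev t) + z.comp (ev s)) = _
    rw [map_add, map_sub, hΨ, hΨ, if_pos rfl, if_neg (by simpa using hs), add_zero]
    rfl
  have := tendsto_nhds_unique hconst tendsto_const_nhds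
  exact hv (sub_eq_self.1 this.symm)

/-- Replacing `x` by any `ψ` in the ball stays in the dual ball of `E` and is weak*-continuous in
`ψ`, so continuity at `Λ` pulls back to `x`. -/
theorem isWeakStarWeakPC_of_isWeakStarWeakPC (h : IsSupNormEvaluation 𝕜 ev)
    {Λ : StrongDual 𝕜 E} (hΛ : IsWeakStarWeakPC 𝕜 Λ) {t : Ω} {x : StrongDual 𝕜 X} {a : ℝ}
    (ha : 0 < a) (hx : ‖x‖ ≤ 1) (hrest : ‖Λ - (a : 𝕜) • x.comp (ev t)‖ ≤ 1 - a) :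
    IsWeakStarWeakPC 𝕜 x := by
  classical
  refine isWeakStarWeakPC_iff.2 ⟨hx, fun Φ => ?_⟩
  obtain ⟨Ψ, hΨ⟩ := h.exists_bidual_extension t Φ
  set Λ' := Λ - (a : 𝕜) • x.comp (ev t) with hΛ'
  let G : WeakDual 𝕜 X → WeakDual 𝕜 E := fun ψ =>
    StrongDual.toWeakDual (Λ' + (a : 𝕜) • (WeakDual.toStrongDual ψ).comp (ev t))
  have hGx : G (StrongDual.toWeakDual x) = StrongDual.toWeakDual Λ := by
    simp [G, hΛ']
  have hGc : Continuous G := WeakDual.continuous_of_continuous_eval fun f =>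
    continuous_const.add (continuous_const.mul (WeakDual.eval_continuous (ev t f)))
  have hG : Set.MapsTo G {ψ | ‖WeakDual.toStrongDual ψ‖ ≤ 1}
      {ψ | ‖WeakDual.toStrongDual ψ‖ ≤ 1} := fun ψ hψ => by
    refine (norm_add_le Λ' ((a : 𝕜) • (WeakDual.toStrongDual ψ).comp (ev t))).trans ?_
    rw [norm_smul, RCLike.norm_of_nonneg ha.le]
    have := mul_le_mul_of_nonneg_left
      ((h.norm_comp_le t (WeakDual.toStrongDual ψ)).trans hψ) ha.le
    linarith
  have hcont := ContinuousWithinAt.comp (f := G) (hGx ▸ (isWeakStarWeakPC_iff.1 hΛ).2 Ψ)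
    hGc.continuousWithinAt hG
  have ha' : (a : 𝕜) ≠ 0 := by exact_mod_cast ha.ne'
  have heq : (fun ψ : WeakDual 𝕜 X => Φ (WeakDual.toStrongDual ψ)) =
      fun ψ => (a : 𝕜)⁻¹ * (Ψ (WeakDual.toStrongDual (G ψ)) - Ψ Λ') := by
    funext ψ
    change _ = (a : 𝕜)⁻¹ * (Ψ (Λ' + (a : 𝕜) • (WeakDual.toStrongDual ψ).comp (ev t)) - Ψ Λ')
    rw [map_add, map_smul, hΨ, if_pos rfl, add_sub_cancel_left, smul_eq_mul,
      inv_mul_cancel_left₀ ha']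
  rw [heq]
  exact continuousWithinAt_const.mul (hcont.sub continuousWithinAt_const)

theorem exists_convex_series [Nonempty Ω] [Nontrivial X] (h : IsSupNormEvaluation 𝕜 ev)
    {Λ : StrongDual 𝕜 E} (hΛ : IsWeakStarWeakPC 𝕜 Λ) :
    ∃ (a : Ω → ℝ) (x : Ω → StrongDual 𝕜 X), (∀ t, 0 ≤ a t) ∧
      (∀ t, a t ≠ 0 → IsOpen ({t} : Set Ω) ∧ IsWeakStarWeakPC 𝕜 (x t)) ∧
      HasSum a 1 ∧ HasSum (fun t => (a t : 𝕜) • (x t).comp (ev t)) Λ := by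
  classical
  obtain ⟨T, hT⟩ := h.exists_linearIsometry
  obtain ⟨y, hy1, rfl⟩ := h.exists_hasSum_of_isWeakStarWeakPC hΛ hT
  have hn : HasSum (fun t => ‖y t‖) ‖y‖ := by simpa using lp.hasSum_norm (by simp) y
  obtain ⟨t₀⟩ := ‹Nonempty Ω›
  -- `‖Λ‖ < 1` is possible, so the missing mass goes to the weight of an arbitrary `t₀`; if
  -- positive, that weight makes `t₀` isolated too.
  let a : Ω → ℝ := fun t => ‖y t‖ + if t = t₀ then 1 - ‖y‖ else 0
  have hya (t : Ω) : ‖y t‖ ≤ a t :=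
    le_add_of_nonneg_right (by split_ifs <;> linarith)
  have hay (t : Ω) : a t ≤ ‖y t‖ + (1 - ‖y‖) :=
    add_le_add_right (by split_ifs <;> linarith) _
  have ha0 (t : Ω) : 0 ≤ a t := (norm_nonneg _).trans (hya t)
  let x : Ω → StrongDual 𝕜 X := fun t => ((a t)⁻¹ : 𝕜) • y t
  have hax (t : Ω) : (a t : 𝕜) • x t = y t := by
    by_cases hat : a t = 0
    · have : y t = 0 := norm_le_zero_iff.1 (hat ▸ hya t)
      rw [this, hat, RCLike.ofReal_zero]
      exact zero_smul 𝕜 (x t)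
    · exact smul_inv_smul₀ (by exact_mod_cast hat) _
  have hax' (t : Ω) : (a t : 𝕜) • (x t).comp (ev t) = (y t).comp (ev t) := by
    rw [← ContinuousLinearMap.smul_comp, hax]
  have hrest (t : Ω) : ‖T y - (y t).comp (ev t)‖ ≤ 1 - a t := by
    rw [← apply_single_of_hasSum hT, ← map_sub, T.norm_map]
    have := lp.norm_sub_norm_compl_sub_single (by simp) y {t}
    simp only [ENNReal.toReal_one, Real.rpow_one, Finset.sum_singleton] at this
    linarith [hay t]
  refine ⟨a, x, ha0, fun t hat => ?_, ?_, ?_⟩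
  · have hpos : 0 < a t := lt_of_le_of_ne (ha0 t) (Ne.symm hat)
    refine ⟨h.isOpen_singleton_of_isWeakStarWeakPC hΛ hpos (hya t) (hrest t),
      h.isWeakStarWeakPC_of_isWeakStarWeakPC hΛ hpos ?_ (by rw [hax']; exact hrest t)⟩
    rw [norm_smul, norm_inv, RCLike.norm_of_nonneg (ha0 t), inv_mul_le_iff₀ hpos, mul_one]
    exact hya t
  · simpa using hn.add (hasSum_ite_eq t₀ (1 - ‖y‖))
  · simpa only [hax'] using hT y

end IsSupNormEvaluation

/-! ### Interpolation in `WC` -/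

namespace WC

variable {𝕜 : Type*} [RCLike 𝕜] {Ω : Type*} [TopologicalSpace Ω]
  {X : Type*} [NormedAddCommGroup X] [NormedSpace 𝕜 X]

theorem norm_le_of_forall_le {f : WC 𝕜 Ω X} {C : ℝ} (hC : 0 ≤ C) (h : ∀ t, ‖f.1 t‖ ≤ C) :
    ‖f‖ ≤ C :=
  lp.norm_le_of_forall_le hC h

/-- Prescribed values in the unit ball at finitely many points are attained by a function in the
unit ball of `WC`. -/
theorem exists_norm_le_one_of_finset [CompactSpace Ω] [T2Space Ω] (F : Finset Ω) (x : Ω → X)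
    (hx : ∀ t ∈ F, ‖x t‖ ≤ 1) : ∃ f : WC 𝕜 Ω X, ‖f‖ ≤ 1 ∧ ∀ t ∈ F, f.1 t = x t := by
  suffices h : ∃ f : C(Ω, X), (∀ t, ‖f t‖ ≤ 1) ∧ ∀ t ∈ F, f t = x t by
    obtain ⟨f, hf, hfx⟩ := h
    obtain ⟨g, hg⟩ := exists_coe_eq (𝕜 := 𝕜) f
      ((toWeakSpaceCLM 𝕜 X).continuous.comp f.continuous)
    exact ⟨g, norm_le_of_forall_le zero_le_one fun t => by rw [hg]; exact hf t,
      fun t ht => by rw [hg, hfx t ht]⟩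
  let _ : NormedSpace ℝ X := NormedSpace.restrictScalars ℝ 𝕜 X
  classical
  induction F using Finset.induction_on with
  | empty => exact ⟨0, by simp, by simp⟩
  | insert a s ha ih =>
    obtain ⟨f, hf, hfx⟩ := ih fun t ht => hx t (Finset.mem_insert_of_mem ht)
    -- A Urysohn function blends in the value at `a`; convexity of the ball keeps the norm bound.
    obtain ⟨h, h0, h1, h01⟩ := exists_continuous_zero_one_of_isClosed
      (s := (s : Set Ω)) (t := {a}) s.finite_toSet.isClosed isClosed_singleton
      (Set.disjoint_singleton_right.2 (by simpa using ha))
    refine ⟨⟨fun t => (1 - h t) • f t + h t • x a, by fun_prop⟩, fun t => ?_, fun t ht => ?_⟩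
    · have hball := convex_closedBall (0 : X) 1
      simpa using hball (by simpa using hf t) (by simpa using hx a (Finset.mem_insert_self a s))
        (sub_nonneg.2 (h01 t).2) (h01 t).1 (by ring : 1 - h t + h t = 1)
    · obtain rfl | ht := Finset.mem_insert.1 ht
      · have : h t = 1 := h1 rfl
        simp [this]
      · have : h t = 0 := h0 ht
        simp [this, hfx t ht]

variable (𝕜 X) in
/-- Evaluation at `t` as a continuous linear map on `WC`. -/
noncomputable def evalCLM (t : Ω) : WC 𝕜 Ω X →L[𝕜] X :=
  (lp.evalCLM 𝕜 (fun _ : Ω => X) ∞ t).comp (WC 𝕜 Ω X).subtypeL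

theorem isSupNormEvaluation_evalCLM [CompactSpace Ω] [T2Space Ω] :
    IsSupNormEvaluation 𝕜 (evalCLM 𝕜 (Ω := Ω) X) where
  norm_apply_le t f := lp.norm_apply_le_norm ENNReal.top_ne_zero f.1 t
  norm_le_of_forall_le f _ hC h := norm_le_of_forall_le (f := f) hC h
  continuous_apply f φ := (WeakBilin.eval_continuous (topDualPairing 𝕜 X).flip φ).comp f.2
  exists_norm_le_one := exists_norm_le_one_of_finset

end WC

/-! ### Reindexing by natural numbers -/

theorem Set.Countable.exists_nat_indexing {α : Type*} [Nonempty α] {S : Set α}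
    (hS : S.Countable) :
    ∃ (J : Set ℕ) (e : ℕ → α), Set.BijOn e J S := by
  obtain ⟨f, hf⟩ := Set.countable_iff_exists_injOn.1 hS
  exact ⟨f '' S, Function.invFunOn f S, Set.BijOn.symm hf.bijOn_image.invOn_invFunOn.symm hf.bijOn_image⟩

theorem Set.BijOn.hasSum_comp {ι α V : Type*} [AddCommMonoid V] [TopologicalSpace V]
    {J : Set ι} {S : Set α} {e : ι → α} (he : Set.BijOn e J S) {g : α → V} {v : V}
    (hg : HasSum g v) (hS : ∀ t, t ∉ S → g t = 0) : HasSum (fun i : J => g (e i)) v := by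
  have h : HasSum (g ∘ ((↑) : S → α)) v :=
    (hasSum_subtype_iff_of_support_subset fun t ht => by_contra fun hn => ht (hS t hn)).2 hg
  exact (he.equiv.hasSum_iff (f := g ∘ ((↑) : S → α))).2 h

theorem theorem4p1 {𝕜 : Type*} [RCLike 𝕜]
    {Ω : Type*} [TopologicalSpace Ω] [CompactSpace Ω] [T2Space Ω] [Nonempty Ω]
    {X : Type*} [NormedAddCommGroup X] [NormedSpace 𝕜 X] [CompleteSpace X] [Nontrivial X]
    (Λ : StrongDual 𝕜 (WC 𝕜 Ω X)) (hΛ : IsWeakStarWeakPC 𝕜 Λ) :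
    ∃ (J : Set ℕ) (α : ℕ → ℝ) (ω : ℕ → Ω) (x : ℕ → StrongDual 𝕜 X),
      Set.InjOn ω J ∧
      (∀ i ∈ J, 0 < α i ∧ α i ≤ 1 ∧ IsOpen ({ω i} : Set Ω) ∧ IsWeakStarWeakPC 𝕜 (x i)) ∧
      HasSum (fun i : J => α i) 1 ∧
      HasSum (fun i : J => ((α i : ℝ) : 𝕜) • WC.diracTensor (ω i) (x i)) Λ := by
  obtain ⟨a, x, ha0, ha, hsum, hseries⟩ :=
    (WC.isSupNormEvaluation_evalCLM (𝕜 := 𝕜) (Ω := Ω) (X := X)).exists_convex_series hΛ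
  obtain ⟨J, e, he⟩ := hsum.summable.countable_support.exists_nat_indexing
  refine ⟨J, a ∘ e, e, x ∘ e, he.injOn, fun i hi => ?_, ?_, ?_⟩
  · have hne : a (e i) ≠ 0 := he.mapsTo hi
    exact ⟨lt_of_le_of_ne (ha0 _) hne.symm, le_hasSum hsum _ fun t _ => ha0 t, ha _ hne⟩
  · exact he.hasSum_comp hsum fun t ht => Function.notMem_support.1 ht
  · refine he.hasSum_comp hseries fun t ht => ?_
    simp only [Function.notMem_support.1 ht, RCLike.ofReal_zero]
    exact ContinuousLinearMap.ext fun f => zero_mul _
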